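/- Let $d\ge 2$ and let $\mathcal P>1/d$. For a density matrix $\rho$ on $\mathbb C^d$ let $\mathcal I(\rho)=\|(\rho-\rho^*)/2\|_2^2$, where $\rho^*$ is the entrywise complex conjugate in the computational basis and $\|A\|_2=\sqrt{\operatorname{Tr}(A^\dagger A)}$. Let $\nu$ be any probability distribution on the set of spectra $\lambda=(\lambda_1,\dots,\lambda_d)$ with $\lambda_i\ge 0$, $\sum_i\lambda_i=1$ and $\sum_i\lambda_i^2=\mathcal P$. The imaginarity-generating power (IGP) at purity $\mathcal P$ of a unitary $U\in U(d)$ is $$\bar{\mathcal I}(U)_{\mathcal P}=\int d\nu(\lambda)\int_{O(d)}d\mu(O)\;\mathcal I\big(U\,O\,\mathrm{diag}(\lambda)\,O^{T}\,U^\dagger\big),$$ where $\mu$ is the normalized Haar measure of the orthogonal group $O(d)$, and the normalized IGP is $\bar{\mathcal I}(U)_N=\bar{\mathcal I}(U)_{\mathcal P}\big/\sup_{V\in U(d)}\bar{\mathcal I}(V)_{\mathcal P}$. The supremum in the denominator is positive, and $\bar{\mathcal I}(\cdot)_N$ is square integrable with respect to the normalized Haar measure of $U(d)$. For Haar-random $U\in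 U(d)$ the variance of the normalized IGP scales as $O(d^{-4})$, with leading term $4/d^4$: there is an absolute constant $C$, independent of $d$, $\mathcal P$ and $\nu$, such that $$\Delta^2\bar{\mathcal I}(U)_N\le\frac{C}{d^4}\qquad\text{and}\qquad\Big|\Delta^2\bar{\mathcal I}(U)_N-\frac{4}{d^4}\Big|\le\frac{C}{d^5}.$$ In particular $d^4\,\Delta^2\bar{\mathcal I}(U)_N\to 4$ as $d\to\infty$. -/

import Mathlib

open MeasureTheory ProbabilityTheory

noncomputable section

namespace ImaginarityPower

/-! ### Haar measure on the unitary group `U(d)` and the orthogonal group `O(d)` -/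

/-- The Borel σ-algebra of the group of unitary matrices over `𝕜` (`𝕜 = ℂ`: the unitary group,
`𝕜 = ℝ`: the orthogonal group), for its topology as a subspace of the space of matrices. -/
instance instMeasurableSpaceUnitaryGroup {𝕜 : Type*} [RCLike 𝕜] (d : ℕ) :
    MeasurableSpace (Matrix.unitaryGroup (Fin d) 𝕜) := borel _

instance instBorelSpaceUnitaryGroup {𝕜 : Type*} [RCLike 𝕜] (d : ℕ) :
    BorelSpace (Matrix.unitaryGroup (Fin d) 𝕜) := ⟨rfl⟩

instance instTopologicalGroupUnitaryGroup {𝕜 : Type*} [RCLike 𝕜] (d : ℕ) :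
    IsTopologicalGroup (Matrix.unitaryGroup (Fin d) 𝕜) :=
  inferInstanceAs (IsTopologicalGroup (unitary (Matrix (Fin d) (Fin d) 𝕜)))

instance instCompactSpaceUnitaryGroup {𝕜 : Type*} [RCLike 𝕜] (d : ℕ) :
    CompactSpace (Matrix.unitaryGroup (Fin d) 𝕜) := by
  have hK : IsCompact (Set.univ.pi fun _ : Fin d => Set.univ.pi fun _ : Fin d =>
      Metric.closedBall (0 : 𝕜) 1) :=
    isCompact_univ_pi fun _ => isCompact_univ_pi fun _ => isCompact_closedBall 0 1
  refine isCompact_iff_compactSpace.mp <| IsCompact.of_isClosed_subset (X := Matrix (Fin d) (Fin d) 𝕜) hK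
    (isClosed_unitary (R := Matrix (Fin d) (Fin d) 𝕜)) ?_
  intro U hU i _ j _
  simpa using entry_norm_bound_of_unitary hU i j

/-- The normalized (total mass one) Haar measure on the group of `d × d` unitary matrices
over `𝕜`. -/
def haar (d : ℕ) (𝕜 : Type*) [RCLike 𝕜] : Measure (Matrix.unitaryGroup (Fin d) 𝕜) :=
  Measure.haarMeasure ⊤

/-! ### Imaginarity of a state -/

/-- The Hilbert–Schmidt norm `‖A‖₂ = √(tr (A† A))`. -/
def hsNorm {d : ℕ} (A : Matrix (Fin d) (Fin d) ℂ) : ℝ :=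
  Real.sqrt (A.conjTranspose * A).trace.re

/-- The imaginarity `‖(ρ - ρ*) / 2‖₂²` of `ρ` in the computational basis, where `ρ*` is the
entrywise complex conjugate of `ρ`. -/
def imaginarity {d : ℕ} (ρ : Matrix (Fin d) (Fin d) ℂ) : ℝ :=
  hsNorm ((1 / 2 : ℂ) • (ρ - ρ.map (starRingEnd ℂ))) ^ 2

/-! ### Random real states of fixed purity -/

/-- The spectra of `d`-dimensional states of purity `P`: probability vectors `(λ₁, …, λ_d)` with
`∑ λᵢ² = P`. -/
def spectra (d : ℕ) (P : ℝ) : Set (Fin d → ℝ) :=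
  {l | (∀ i, 0 ≤ l i) ∧ ∑ i, l i = 1 ∧ ∑ i, l i ^ 2 = P}

/-- `ν` is a probability distribution on the spectra of `d`-dimensional states of purity `P`. -/
structure IsSpectralDistribution {d : ℕ} (P : ℝ) (ν : Measure (Fin d → ℝ)) : Prop where
  isProbabilityMeasure : IsProbabilityMeasure ν
  ae_mem_spectra : ∀ᵐ l ∂ν, l ∈ spectra d P

/-- The real state `O diag(λ₁, …, λ_d) Oᵀ`, as a complex matrix. -/
def realState {d : ℕ} (O : Matrix.orthogonalGroup (Fin d) ℝ) (l : Fin d → ℝ) :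
    Matrix (Fin d) (Fin d) ℂ :=
  ((O : Matrix (Fin d) (Fin d) ℝ) * Matrix.diagonal l *
    (O : Matrix (Fin d) (Fin d) ℝ).transpose).map (algebraMap ℝ ℂ)

/-! ### Imaginarity-generating power -/

/-- The imaginarity-generating power of the unitary `U`: the average imaginarity of `U ρ U†` over
random real states `ρ = O diag(λ) Oᵀ`, with `O` Haar distributed in the orthogonal group and the
spectrum `λ` distributed according to `ν`. It is the purity-constrained one at purity `P` when `ν`
is a distribution on the spectra of purity `P`. -/
def igp {d : ℕ} (ν : Measure (Fin d → ℝ)) (U : Matrix.unitaryGroup (Fin d) ℂ) : ℝ :=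
  ∫ l, ∫ O, imaginarity ((U : Matrix (Fin d) (Fin d) ℂ) * realState O l *
    (U : Matrix (Fin d) (Fin d) ℂ).conjTranspose) ∂(haar d ℝ) ∂ν

/-- The maximal imaginarity-generating power over all unitaries of dimension `d`. -/
def igpMax {d : ℕ} (ν : Measure (Fin d → ℝ)) : ℝ :=
  ⨆ U : Matrix.unitaryGroup (Fin d) ℂ, igp ν U

/-- The normalized imaginarity-generating power. -/
def normalizedIGP {d : ℕ} (ν : Measure (Fin d → ℝ)) (U : Matrix.unitaryGroup (Fin d) ℂ) : ℝ :=
  igp ν U / igpMax ν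

end ImaginarityPower

end

/-! Write `W = U Uᵀ`, a symmetric unitary matrix, so that its entrywise conjugate is its inverse.
For a real state `X = O diag(λ) Oᵀ` the imaginarity of `U X U†` is half of `P - tr (X C X B)`, where
`B = Uᵀ U` and `C` is both its conjugate and its inverse. Averaging over `O` leaves a positive
constant times `d² - |tr W|²`, in which the spectrum enters only through its purity. A suitable
diagonal unitary has `tr W = 0`, so the normalized power is exactly `1 - |tr W|² / d²`, with no
trace of `P` or `ν`, and its variance is that of `|tr W|²` divided by `d⁴`.

It remains to compute moments. Since Haar measure is invariant, the integral of any derivative along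
a one-parameter subgroup vanishes. Applied to matrix entries and summed over the generators, this
turns into linear relations between averages of products of traces. Over `O(d)` two such relations
determine the average of `tr (X C X B)` (`integral_trace_mul_mul_mul`). Over `U(d)` they give the
mean of `|tr W|²` as `2d/(d+1)` (`integral_trace_mul_trace`) and the mean of `|tr W|⁴` as
`8(d²+2d-2)/((d+1)(d+3))` (`integral_trace_sq_mul_trace_sq`). These tend to 2 and 8, so the variance
of `|tr W|²` tends to `8 - 2² = 4`, with an error of order `1/d`. -/

noncomputable section

namespace ImaginarityPower

open Matrix

/-! ### Integration by parts for Haar measure. -/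

section IntegrationByParts

open NormedSpace
open scoped Matrix.Norms.Operator

variable {d : ℕ} {𝕜 : Type*} [RCLike 𝕜]

instance instIsProbabilityMeasureHaar : IsProbabilityMeasure (haar d 𝕜) := by
  refine ⟨?_⟩
  simpa [haar] using Measure.haarMeasure_self (K₀ := (⊤ : TopologicalSpace.PositiveCompacts
    (Matrix.unitaryGroup (Fin d) 𝕜)))

instance instIsMulLeftInvariantHaar : (haar d 𝕜).IsMulLeftInvariant := by
  unfold haar; infer_instance

/-- A continuous function on the unitary group is integrable for the Haar measure. -/
theorem integrable_haar {f : unitaryGroup (Fin d) 𝕜 → ℂ} (hf : Continuous f) :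
    Integrable f (haar d 𝕜) :=
  hf.integrable_of_hasCompactSupport (HasCompactSupport.of_compactSpace f)

/-- The one-parameter group `t ↦ exp (t A)` generated by a skew-Hermitian matrix `A`. -/
def oneParam (A : Matrix (Fin d) (Fin d) 𝕜) (hA : Aᴴ = -A) (t : ℝ) : unitaryGroup (Fin d) 𝕜 :=
  ⟨exp (t • A), by
    have h : (exp (t • A))ᴴ = exp (-(t • A)) := by
      rw [← exp_conjTranspose, conjTranspose_smul, hA, star_trivial, smul_neg]
    rw [mem_unitaryGroup_iff, star_eq_conjTranspose, h,
      ← Matrix.exp_add_of_commute _ _ (Commute.refl (t • A)).neg_right, add_neg_cancel, exp_zero]⟩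

theorem coe_oneParam (A : Matrix (Fin d) (Fin d) 𝕜) (hA : Aᴴ = -A) (t : ℝ) :
    (oneParam A hA t : Matrix (Fin d) (Fin d) 𝕜) = exp (t • A) := rfl

theorem oneParam_add (A : Matrix (Fin d) (Fin d) 𝕜) (hA : Aᴴ = -A) (s t : ℝ) :
    oneParam A hA (s + t) = oneParam A hA s * oneParam A hA t := by
  apply Subtype.ext
  simp only [coe_oneParam, UnitaryGroup.mul_val, add_smul]
  exact Matrix.exp_add_of_commute _ _ (((Commute.refl A).smul_left s).smul_right t)

theorem oneParam_zero (A : Matrix (Fin d) (Fin d) 𝕜) (hA : Aᴴ = -A) : oneParam A hA 0 = 1 := by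
  apply Subtype.ext
  simp [coe_oneParam]

theorem hasDerivAt_oneParam (A : Matrix (Fin d) (Fin d) 𝕜) (hA : Aᴴ = -A)
    (U : unitaryGroup (Fin d) 𝕜) :
    HasDerivAt (fun t => (↑(oneParam A hA t * U) : Matrix (Fin d) (Fin d) 𝕜)) (A * U) 0 := by
  have h := (hasDerivAt_exp_smul_const (𝕂 := ℝ) A 0).mul_const (U : Matrix (Fin d) (Fin d) 𝕜)
  rw [zero_smul, exp_zero, one_mul] at h
  exact h

/-- The integral over the unitary group of a derivative along a one-parameter group vanishes. -/
theorem integral_eq_zero_of_hasDerivAt_oneParam {A : Matrix (Fin d) (Fin d) 𝕜} (hA : Aᴴ = -A)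
    {f g : unitaryGroup (Fin d) 𝕜 → ℂ} (hf : Continuous f) (hg : Continuous g)
    (h : ∀ U, HasDerivAt (fun t => f (oneParam A hA t * U)) (g U) 0) :
    ∫ U, g U ∂haar d 𝕜 = 0 := by
  obtain ⟨C, hC⟩ : ∃ C, ∀ U, ‖g U‖ ≤ C := by
    obtain ⟨C, hC⟩ := isCompact_univ.exists_bound_of_continuousOn hg.continuousOn
    exact ⟨C, fun U => hC U trivial⟩
  have hder : ∀ U t, HasDerivAt (fun t => f (oneParam A hA t * U))
      (g (oneParam A hA t * U)) t := by
    intro U t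
    -- By the group law, the derivative at time `t` is the derivative at time 0 taken at the
    -- translated point.
    have h1 := h (oneParam A hA t * U)
    rw [← sub_self t] at h1
    have h2 := h1.comp_sub_const t t
    refine h2.congr_of_eventuallyEq (Filter.Eventually.of_forall fun s => ?_)
    simp only
    rw [← mul_assoc, ← oneParam_add, sub_add_cancel]
  have key := hasDerivAt_integral_of_dominated_loc_of_deriv_le (μ := haar d 𝕜) (x₀ := (0 : ℝ))
    (F := fun t U => f (oneParam A hA t * U)) (F' := fun t U => g (oneParam A hA t * U))
    (s := Set.univ) (bound := fun _ => C) Filter.univ_mem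
    (Filter.Eventually.of_forall fun t => (hf.comp (continuous_const_mul _)).aestronglyMeasurable)
    (integrable_haar (hf.comp (continuous_const_mul _)))
    (hg.comp (continuous_const_mul _)).aestronglyMeasurable
    (Filter.Eventually.of_forall fun U t _ => hC _) (integrable_const C)
    (Filter.Eventually.of_forall fun U t _ => hder U t)
  have h3 := key.2
  -- Left invariance makes the integral constant in `t`, so its derivative is also 0.
  simp only [integral_mul_left_eq_self] at h3
  exact h3.unique (hasDerivAt_const _ _)

end IntegrationByParts

/-! ### Differentiation of matrix curves entry by entry. -/

section EntrywiseDerivative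

variable {d : ℕ} {𝕜 : Type*} [RCLike 𝕜]

/-- The curve of matrices `M` is entrywise differentiable at `0`, with derivative `M'`. -/
def HasEntryDerivAt (M : ℝ → Matrix (Fin d) (Fin d) 𝕜) (M' : Matrix (Fin d) (Fin d) 𝕜) : Prop :=
  ∀ i j, HasDerivAt (fun t => M t i j) (M' i j) 0

namespace HasEntryDerivAt

variable {M N : ℝ → Matrix (Fin d) (Fin d) 𝕜} {M' N' : Matrix (Fin d) (Fin d) 𝕜}

theorem const (C : Matrix (Fin d) (Fin d) 𝕜) : HasEntryDerivAt (fun _ => C) 0 :=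
  fun i j => hasDerivAt_const 0 (C i j)

theorem mul (hM : HasEntryDerivAt M M') (hN : HasEntryDerivAt N N') :
    HasEntryDerivAt (fun t => M t * N t) (M' * N 0 + M 0 * N') := by
  intro i j
  simp only [Matrix.mul_apply, Matrix.add_apply, ← Finset.sum_add_distrib]
  exact HasDerivAt.fun_sum fun k _ => (hM i k).mul (hN k j)

theorem mul_const (hM : HasEntryDerivAt M M') (C : Matrix (Fin d) (Fin d) 𝕜) :
    HasEntryDerivAt (fun t => M t * C) (M' * C) := by
  simpa using hM.mul (const C)

theorem transpose (hM : HasEntryDerivAt M M') : HasEntryDerivAt (fun t => (M t)ᵀ) M'ᵀ :=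
  fun i j => hM j i

theorem trace (hM : HasEntryDerivAt M M') : HasDerivAt (fun t => (M t).trace) M'.trace 0 :=
  HasDerivAt.fun_sum fun i _ => hM i i

theorem conj {M : ℝ → Matrix (Fin d) (Fin d) ℂ} {M' : Matrix (Fin d) (Fin d) ℂ}
    (hM : HasEntryDerivAt M M') :
    HasEntryDerivAt (fun t => (M t).map (starRingEnd ℂ)) (M'.map (starRingEnd ℂ)) :=
  fun i j => (hM i j).star

theorem ofReal {M : ℝ → Matrix (Fin d) (Fin d) ℝ} {M' : Matrix (Fin d) (Fin d) ℝ}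
    (hM : HasEntryDerivAt M M') :
    HasEntryDerivAt (fun t => (M t).map (algebraMap ℝ ℂ)) (M'.map (algebraMap ℝ ℂ)) :=
  fun i j => (hM i j).ofReal_comp

end HasEntryDerivAt

/-- Passing to entries leaves behind the operator norm used to differentiate the exponential;
products, transposes, conjugates and traces then follow scalar rules. -/
theorem hasEntryDerivAt_oneParam (A : Matrix (Fin d) (Fin d) 𝕜) (hA : Aᴴ = -A)
    (U : unitaryGroup (Fin d) 𝕜) :
    HasEntryDerivAt (fun t => (↑(oneParam A hA t * U) : Matrix (Fin d) (Fin d) 𝕜)) (A * U) := by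
  have h := hasDerivAt_oneParam A hA U
  intro i j
  exact hasDerivAt_pi.1 (hasDerivAt_pi.1 h i) j

end EntrywiseDerivative

/-! ### Contractions of elementary matrices into traces. -/

section Contractions

variable {n R : Type*} [Fintype n] [DecidableEq n] [CommRing R]

/-- The `(a, b)` entry of `P E_ab Q` is `P_aa Q_bb`, while for `P E_ba Q` it is `P_ab Q_ab`. These
two contractions convert every summed derivative below into traces. -/
theorem sum_mul_single_mul_apply (P Q : Matrix n n R) :
    ∑ a, ∑ b, (P * single a b 1 * Q : Matrix n n R) a b = P.trace * Q.trace := by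
  simp only [Matrix.trace, Finset.sum_mul_sum, Matrix.diag]
  refine Finset.sum_congr rfl fun a _ => Finset.sum_congr rfl fun b _ => ?_
  rw [Matrix.mul_apply, Finset.sum_eq_single b]
  · simp
  · intro c _ hc
    simp [hc]
  · simp

theorem sum_mul_single_swap_mul_apply (P Q : Matrix n n R) :
    ∑ a, ∑ b, (P * single b a 1 * Q : Matrix n n R) a b = (P * Qᵀ).trace := by
  simp only [Matrix.trace, Matrix.diag]
  refine Finset.sum_congr rfl fun a _ => ?_
  rw [Matrix.mul_apply]
  refine Finset.sum_congr rfl fun b _ => ?_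
  rw [Matrix.mul_apply, Finset.sum_eq_single a]
  · simp
  · intro c _ hc
    simp [hc]
  · simp

theorem sum_mul_rot_mul_apply (P Q : Matrix n n R) :
    ∑ a, ∑ b, (P * (single a b 1 - single b a 1) * Q : Matrix n n R) a b
      = P.trace * Q.trace - (P * Qᵀ).trace := by
  simp only [Matrix.mul_sub, Matrix.sub_mul, Matrix.sub_apply, Finset.sum_sub_distrib,
    sum_mul_single_mul_apply, sum_mul_single_swap_mul_apply]

theorem sum_mul_trace_rot_mul (Q K : Matrix n n R) :
    ∑ a, ∑ b, Q a b * ((single a b 1 - single b a 1) * K).trace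
      = (Q * K).trace - (Q * Kᵀ).trace := by
  simp only [Matrix.sub_mul, Matrix.trace_sub, Matrix.trace_single_mul, mul_sub,
    Finset.sum_sub_distrib]
  simp [Matrix.trace, Matrix.mul_apply]

end Contractions

/-! ### Random real states and their derivatives under rotations. -/

section Orthogonal

variable {d : ℕ} {l : Fin d → ℝ}

theorem continuous_realState (l : Fin d → ℝ) :
    Continuous fun O : orthogonalGroup (Fin d) ℝ => realState O l := by
  unfold realState
  have h : Continuous fun O : orthogonalGroup (Fin d) ℝ => (O : Matrix (Fin d) (Fin d) ℝ) :=
    continuous_subtype_val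
  exact ((h.matrix_mul continuous_const).matrix_mul h.matrix_transpose).matrix_map
    Complex.continuous_ofReal

theorem transpose_realState (O : orthogonalGroup (Fin d) ℝ) (l : Fin d → ℝ) :
    (realState O l)ᵀ = realState O l := by
  rw [realState, ← transpose_map, transpose_mul, transpose_mul, transpose_transpose,
    diagonal_transpose, Matrix.mul_assoc]

theorem orthogonal_transpose_mul_self (O : orthogonalGroup (Fin d) ℝ) :
    (O : Matrix (Fin d) (Fin d) ℝ)ᵀ * (O : Matrix (Fin d) (Fin d) ℝ) = 1 :=
  (mem_orthogonalGroup_iff' _ _).1 O.2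

theorem trace_realState (O : orthogonalGroup (Fin d) ℝ) (l : Fin d → ℝ) :
    (realState O l).trace = ((∑ i, l i : ℝ) : ℂ) := by
  have h : ((O : Matrix (Fin d) (Fin d) ℝ) * diagonal l
      * (O : Matrix (Fin d) (Fin d) ℝ)ᵀ).trace = ∑ i, l i := by
    rw [Matrix.trace_mul_comm, ← Matrix.mul_assoc, orthogonal_transpose_mul_self, Matrix.one_mul,
      Matrix.trace_diagonal]
  rw [← h, realState]
  simp [Matrix.trace]

theorem realState_mul_self (O : orthogonalGroup (Fin d) ℝ) (l : Fin d → ℝ) :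
    realState O l * realState O l = realState O fun i => l i ^ 2 := by
  rw [realState, ← Matrix.map_mul, realState]
  congr 1
  have h : diagonal (fun i => l i ^ 2) = diagonal l * diagonal l := by
    rw [diagonal_mul_diagonal]; simp only [sq]
  calc _ = (O : Matrix (Fin d) (Fin d) ℝ) * diagonal l
        * ((O : Matrix (Fin d) (Fin d) ℝ)ᵀ * (O : Matrix (Fin d) (Fin d) ℝ)) * diagonal l
        * (O : Matrix (Fin d) (Fin d) ℝ)ᵀ := by simp only [Matrix.mul_assoc]
    _ = _ := by rw [orthogonal_transpose_mul_self, h]; simp only [Matrix.mul_assoc, Matrix.one_mul]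

theorem conjTranspose_rot (a b : Fin d) :
    (single a b 1 - single b a 1 : Matrix (Fin d) (Fin d) ℝ)ᴴ
      = -(single a b 1 - single b a 1) := by
  simp

/-- The state moves by conjugation, and a rotation generator `R` has `Rᵀ = -R`, so the derivative is
the commutator of `R` with the state. -/
theorem hasEntryDerivAt_realState (l : Fin d → ℝ) (a b : Fin d)
    (O : orthogonalGroup (Fin d) ℝ) :
    HasEntryDerivAt (fun t => realState (oneParam _ (conjTranspose_rot a b) t * O) l)
      ((single a b 1 - single b a 1) * realState O l
        - realState O l * (single a b 1 - single b a 1)) := by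
  have h := hasEntryDerivAt_oneParam _ (conjTranspose_rot a b) O
  have h2 := ((h.mul_const (diagonal l)).mul h.transpose).ofReal
  simp only [oneParam_zero, one_mul] at h2
  have hT : (single a b 1 - single b a 1 : Matrix (Fin d) (Fin d) ℝ)ᵀ
      = -(single a b 1 - single b a 1) := conjTranspose_rot a b
  have hmap : (single a b 1 - single b a 1 : Matrix (Fin d) (Fin d) ℝ).map (algebraMap ℝ ℂ)
      = single a b 1 - single b a 1 := by
    rw [Matrix.map_sub _ (map_sub _), map_single, map_single, map_one]
  have e : (single a b 1 - single b a 1) * realState O l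
        - realState O l * (single a b 1 - single b a 1)
      = ((single a b 1 - single b a 1) * (O : Matrix (Fin d) (Fin d) ℝ) * diagonal l
          * (O : Matrix (Fin d) (Fin d) ℝ)ᵀ + (O : Matrix (Fin d) (Fin d) ℝ) * diagonal l
          * ((single a b 1 - single b a 1) * (O : Matrix (Fin d) (Fin d) ℝ))ᵀ).map
          (algebraMap ℝ ℂ) := by
    rw [transpose_mul, hT, ← hmap, realState, ← Matrix.map_mul, ← Matrix.map_mul,
      ← Matrix.map_sub _ (map_sub _)]
    congr 1
    simp only [Matrix.mul_neg, sub_eq_add_neg, Matrix.mul_assoc]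
  rw [e]
  exact h2

/-- Summed integration by parts over the infinitesimal rotations of the coordinate planes. -/
theorem integral_sum_rot_eq_zero {f g : Fin d → Fin d → orthogonalGroup (Fin d) ℝ → ℂ}
    (hf : ∀ a b, Continuous (f a b)) (hg : ∀ a b, Continuous (g a b))
    (h : ∀ a b O, HasDerivAt (fun t => f a b (oneParam _ (conjTranspose_rot a b) t * O))
      (g a b O) 0) :
    ∫ O, ∑ a, ∑ b, g a b O ∂haar d ℝ = 0 := by
  rw [integral_finsetSum _ fun a _ => integrable_finsetSum _ fun b _ => integrable_haar (hg a b)]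
  refine Finset.sum_eq_zero fun a _ => ?_
  rw [integral_finsetSum _ fun b _ => integrable_haar (hg a b)]
  exact Finset.sum_eq_zero fun b _ =>
    integral_eq_zero_of_hasDerivAt_oneParam _ (hf a b) (hg a b) (h a b)

end Orthogonal

/-! ### First and second moments of random real states. -/

section OrthogonalMoments

/-- The space of complex `d × d` matrices. -/
abbrev CMat (d : ℕ) := Matrix (Fin d) (Fin d) ℂ

/-- The generator of the rotations in the plane of the coordinates `a` and `b`. -/
abbrev rot {d : ℕ} (a b : Fin d) : Matrix (Fin d) (Fin d) ℂ := single a b 1 - single b a 1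

variable {d : ℕ} {l : Fin d → ℝ}

/-- The first moment of the random state `O diag(l) Oᵀ`, paired with a symmetric matrix. -/
theorem integral_trace_realState_mul (l : Fin d → ℝ) {B : Matrix (Fin d) (Fin d) ℂ} (hB : Bᵀ = B) :
    d * ∫ O, (realState O l * B).trace ∂haar d ℝ = ((∑ i, l i : ℝ) : ℂ) * B.trace := by
  have hX := continuous_realState l
  have h := integral_sum_rot_eq_zero
    (f := fun a b O => (realState O l * B : CMat d) a b)
    (g := fun a b O => ((rot a b * realState O l
        - realState O l * rot a b) * B : CMat d) a b)
    (fun a b => (hX.matrix_mul continuous_const).matrix_elem a b)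
    (fun a b => (((continuous_const.matrix_mul hX).sub
      (hX.matrix_mul continuous_const)).matrix_mul continuous_const).matrix_elem a b)
    (fun a b O => ((hasEntryDerivAt_realState l a b O).mul_const B) a b)
  have key : ∀ O : orthogonalGroup (Fin d) ℝ,
      ∑ a, ∑ b, ((rot a b * realState O l
        - realState O l * rot a b) * B : CMat d) a b
      = d * (realState O l * B).trace - ((∑ i, l i : ℝ) : ℂ) * B.trace := by
    intro O
    have e1 := sum_mul_rot_mul_apply 1 (realState O l * B)
    have e2 := sum_mul_rot_mul_apply (realState O l) B
    rw [Matrix.trace_one, Fintype.card_fin, Matrix.one_mul, Matrix.trace_transpose] at e1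
    rw [trace_realState, hB] at e2
    have : ∀ a b, ((rot a b * realState O l
        - realState O l * rot a b) * B : CMat d) a b
        = (1 * rot a b * (realState O l * B) : CMat d) a b
          - (realState O l * rot a b * B : CMat d) a b := by
      intro a b
      rw [← Matrix.sub_apply, Matrix.sub_mul, Matrix.one_mul, Matrix.mul_assoc]
    simp only [this, Finset.sum_sub_distrib]
    rw [e1, e2]
    ring
  simp only [key] at h
  rw [integral_sub (integrable_haar (by fun_prop)) (integrable_const _), integral_const_mul] at h
  simpa [sub_eq_zero] using h

/-- A linear relation between the second moments of the random state `O diag(l) Oᵀ`, from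
integration by parts of the entries of `X C X B`. -/
theorem integral_trace_mul_mul_mul_relation (h1 : ∑ i, l i = 1) {P : ℝ} (h2 : ∑ i, l i ^ 2 = P)
    {B C : Matrix (Fin d) (Fin d) ℂ} (hB : Bᵀ = B) (hC : Cᵀ = C) (hBC : B * C = 1) :
    (d + 1) * ∫ O, (realState O l * C * realState O l * B).trace ∂haar d ℝ
      + ∫ O, (realState O l * B).trace * (realState O l * C).trace ∂haar d ℝ
      = 1 + P + B.trace * ∫ O, ((realState O fun i => l i ^ 2) * C).trace ∂haar d ℝ := by
  have hX := continuous_realState l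
  have hX2 := continuous_realState fun i => l i ^ 2
  have hCB : C * B = 1 := mul_eq_one_comm.1 hBC
  have h := integral_sum_rot_eq_zero
    (f := fun a b O => (realState O l * C * realState O l * B : CMat d) a b)
    (g := fun a b O => (((rot a b * realState O l - realState O l * rot a b) * C * realState O l
      + realState O l * C * (rot a b * realState O l - realState O l * rot a b)) * B : CMat d) a b)
    (fun a b => by fun_prop) (fun a b => by fun_prop)
    (fun a b O => by
      have hd := hasEntryDerivAt_realState l a b O
      have := (((hd.mul_const C).mul hd).mul_const B) a b
      simpa only [oneParam_zero, one_mul] using this)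
  have key : ∀ O : orthogonalGroup (Fin d) ℝ,
      ∑ a, ∑ b, (((rot a b * realState O l - realState O l * rot a b) * C * realState O l
      + realState O l * C * (rot a b * realState O l - realState O l * rot a b)) * B : CMat d) a b
      = (d + 1) * (realState O l * C * realState O l * B).trace
        + (realState O l * B).trace * (realState O l * C).trace
        - (1 + P + B.trace * ((realState O fun i => l i ^ 2) * C).trace) := by
    intro O
    have hXT := transpose_realState O l
    have hXX := realState_mul_self O l
    have ht1 := trace_realState O l
    have ht2 := trace_realState O fun i => l i ^ 2
    rw [h1] at ht1
    rw [h2] at ht2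
    set X := realState O l
    have e1 := sum_mul_rot_mul_apply 1 (X * C * X * B)
    have e2 := sum_mul_rot_mul_apply X (C * X * B)
    have e3 := sum_mul_rot_mul_apply (X * C) (X * B)
    have e4 := sum_mul_rot_mul_apply (X * C * X) B
    have s1 : (B * (X * (C * X))).trace = (X * C * X * B).trace := by
      rw [Matrix.trace_mul_comm]; simp only [Matrix.mul_assoc]
    have s2 : (X * (B * (X * C))).trace = (X * C * X * B).trace := by
      rw [← Matrix.mul_assoc, Matrix.trace_mul_comm]; simp only [Matrix.mul_assoc]
    -- Here `B` and `C` being inverse to each other matters: this trace and the next reduce to `tr X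
    -- = 1` and `tr X² = P`, so that no further unknown moment enters.
    have s3 : (C * (X * B)).trace = 1 := by
      rw [Matrix.trace_mul_comm, Matrix.mul_assoc, hBC, Matrix.mul_one, ht1, Complex.ofReal_one]
    have s4 : (X * C * (B * X)).trace = P := by
      rw [Matrix.mul_assoc, ← Matrix.mul_assoc C, hCB, Matrix.one_mul, hXX, ht2]
    have s5 : (X * C * X).trace = ((realState O fun i => l i ^ 2) * C).trace := by
      rw [Matrix.trace_mul_comm, ← Matrix.mul_assoc, hXX]
    simp only [Matrix.transpose_mul, hXT, hB, hC, Matrix.trace_one, Fintype.card_fin,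
      Matrix.one_mul] at e1 e2 e3 e4
    have : ∀ a b, (((rot a b * X - X * rot a b) * C * X
      + X * C * (rot a b * X - X * rot a b)) * B : CMat d) a b
        = (rot a b * (X * C * X * B) : CMat d) a b - (X * rot a b * (C * X * B) : CMat d) a b
          + (X * C * rot a b * (X * B) : CMat d) a b - (X * C * X * rot a b * B : CMat d) a b := by
      intro a b
      rw [← Matrix.sub_apply, ← Matrix.add_apply, ← Matrix.sub_apply]
      refine congrFun (congrFun ?_ a) b
      generalize rot a b = R
      simp only [Matrix.sub_mul, Matrix.mul_sub, Matrix.add_mul, Matrix.mul_assoc]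
      abel
    simp only [this, Finset.sum_sub_distrib, Finset.sum_add_distrib]
    rw [e1, e2, e3, e4, s4, s5]
    simp only [Matrix.mul_assoc] at s1 s2 s3 ⊢
    rw [s1, s2, s3, ht1]
    push_cast
    ring
  simp only [key] at h
  rw [integral_sub (integrable_haar (by fun_prop)) (integrable_haar (by fun_prop)),
    integral_add (integrable_haar (by fun_prop)) (integrable_haar (by fun_prop)),
    integral_add (integrable_const _) (integrable_haar (by fun_prop))] at h
  simp only [integral_const_mul] at h
  simpa [sub_eq_zero] using h

/-- A linear relation between the second moments of the random state `O diag(l) Oᵀ`, from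
integration by parts of the entries of `X B` times `tr (X C)`. -/
theorem integral_trace_mul_trace_relation (h1 : ∑ i, l i = 1) {P : ℝ} (h2 : ∑ i, l i ^ 2 = P)
    {B C : Matrix (Fin d) (Fin d) ℂ} (hB : Bᵀ = B) (hC : Cᵀ = C) (hBC : B * C = 1) :
    d * ∫ O, (realState O l * B).trace * (realState O l * C).trace ∂haar d ℝ
      + 2 * ∫ O, (realState O l * C * realState O l * B).trace ∂haar d ℝ
      = 2 * P + B.trace * ∫ O, (realState O l * C).trace ∂haar d ℝ := by
  have hX := continuous_realState l
  have h := integral_sum_rot_eq_zero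
    (f := fun a b O => (realState O l * B : CMat d) a b * (realState O l * C).trace)
    (g := fun a b O => ((rot a b * realState O l - realState O l * rot a b) * B : CMat d) a b
        * (realState O l * C).trace
      + (realState O l * B : CMat d) a b
        * ((rot a b * realState O l - realState O l * rot a b) * C).trace)
    (fun a b => by fun_prop) (fun a b => by fun_prop)
    (fun a b O => by
      have hd := hasEntryDerivAt_realState l a b O
      have := ((hd.mul_const B) a b).fun_mul (hd.mul_const C).trace
      simpa only [oneParam_zero, one_mul] using this)
  have key : ∀ O : orthogonalGroup (Fin d) ℝ,
      ∑ a, ∑ b, (((rot a b * realState O l - realState O l * rot a b) * B : CMat d) a b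
        * (realState O l * C).trace
      + (realState O l * B : CMat d) a b
        * ((rot a b * realState O l - realState O l * rot a b) * C).trace)
      = d * ((realState O l * B).trace * (realState O l * C).trace)
        + 2 * (realState O l * C * realState O l * B).trace
        - (2 * P + B.trace * (realState O l * C).trace) := by
    intro O
    have hXT := transpose_realState O l
    have hXX := realState_mul_self O l
    have ht1 := trace_realState O l
    have ht2 := trace_realState O fun i => l i ^ 2
    rw [h1] at ht1
    rw [h2] at ht2
    set X := realState O l
    have e1 := sum_mul_rot_mul_apply 1 (X * B)
    have e2 := sum_mul_rot_mul_apply X B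
    have e3 := sum_mul_trace_rot_mul (X * B) (X * C - C * X)
    have s1 : (X * B * (X * C)).trace = (X * C * X * B).trace := by
      rw [Matrix.trace_mul_comm]; simp only [Matrix.mul_assoc]
    have s2 : (X * B * (C * X)).trace = P := by
      rw [Matrix.mul_assoc, ← Matrix.mul_assoc B, hBC, Matrix.one_mul, hXX, ht2]
    simp only [Matrix.transpose_sub, Matrix.transpose_mul, hXT, hB, hC, Matrix.trace_one,
      Fintype.card_fin, Matrix.one_mul] at e1 e2 e3
    simp only [Matrix.mul_sub, Matrix.trace_sub, s1, s2] at e3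
    have t1 : ∀ a b, ((rot a b * X - X * rot a b) * B : CMat d) a b * (X * C).trace
        = (rot a b * (X * B) : CMat d) a b * (X * C).trace
          - (X * rot a b * B : CMat d) a b * (X * C).trace := by
      intro a b
      rw [← sub_mul, ← Matrix.sub_apply, Matrix.sub_mul, Matrix.mul_assoc]
    have t2 : ∀ a b, ((rot a b * X - X * rot a b) * C).trace
        = (rot a b * (X * C)).trace - (rot a b * (C * X)).trace := by
      intro a b
      rw [Matrix.sub_mul, Matrix.trace_sub, Matrix.mul_assoc, Matrix.mul_assoc X,
        Matrix.trace_mul_comm X, Matrix.mul_assoc]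
    simp only [t1, t2, Finset.sum_add_distrib, Finset.sum_sub_distrib, ← Finset.sum_mul]
    rw [e1, e2, e3, ht1, Matrix.trace_mul_comm B X]
    push_cast
    ring
  simp only [key] at h
  rw [integral_sub (integrable_haar (by fun_prop)) (integrable_haar (by fun_prop)),
    integral_add (integrable_haar (by fun_prop)) (integrable_haar (by fun_prop)),
    integral_add (integrable_const _) (integrable_haar (by fun_prop))] at h
  simp only [integral_const_mul] at h
  simpa [sub_eq_zero] using h

/-- The second moment of the random state `X = O diag(l) Oᵀ`, paired with a symmetric matrix and
its inverse. -/
theorem integral_trace_mul_mul_mul (hd : 2 ≤ d) (h1 : ∑ i, l i = 1) {P : ℝ}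
    (h2 : ∑ i, l i ^ 2 = P) {B C : Matrix (Fin d) (Fin d) ℂ} (hB : Bᵀ = B) (hC : Cᵀ = C)
    (hBC : B * C = 1) :
    ∫ O, (realState O l * C * realState O l * B).trace ∂haar d ℝ
      = P - (P - 1 / d) / ((d - 1) * (d + 2)) * (d ^ 2 - B.trace * C.trace) := by
  have r1 := integral_trace_mul_mul_mul_relation h1 h2 hB hC hBC
  have r2 := integral_trace_mul_trace_relation h1 h2 hB hC hBC
  have m1 := integral_trace_realState_mul l hC
  have m2 := integral_trace_realState_mul (fun i => l i ^ 2) hC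
  rw [h1] at m1
  rw [h2] at m2
  have d0 : (d : ℂ) ≠ 0 := by exact_mod_cast (by omega : d ≠ 0)
  have d1 : (d : ℂ) - 1 ≠ 0 := by
    rw [sub_ne_zero]; exact_mod_cast (by omega : d ≠ 1)
  have d2 : (d : ℂ) + 2 ≠ 0 := by exact_mod_cast (by omega : d + 2 ≠ 0)
  set φ := ∫ O, (realState O l * C * realState O l * B).trace ∂haar d ℝ
  set ψ := ∫ O, (realState O l * B).trace * (realState O l * C).trace ∂haar d ℝ
  set u := ∫ O, (realState O l * C).trace ∂haar d ℝ
  set v := ∫ O, ((realState O fun i => l i ^ 2) * C).trace ∂haar d ℝ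
  push_cast at m1
  have : (d : ℂ) * ((d - 1) * (d + 2)) * φ = (d : ℂ) * ((d - 1) * (d + 2)) * P
      - (d * P - 1) * (d ^ 2 - B.trace * C.trace) := by
    -- The combination `d * r1 - r2` eliminates `ψ` and leaves `φ` with coefficient `d(d+1) - 2 =
    -- (d-1)(d+2)`; the additional factor `d` lets `m1` and `m2` replace `u` and `v`.
    linear_combination (d : ℂ) ^ 2 * r1 - d * r2 + d * B.trace * m2 - B.trace * m1
  field_simp
  linear_combination this

end OrthogonalMoments

/-! ### Second and fourth moments of the trace of `U Uᵀ`. -/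

section UnitaryMoments

variable {d : ℕ}

/-- The symmetric unitary matrix `U Uᵀ`. -/
def symUnitary (U : unitaryGroup (Fin d) ℂ) : CMat d :=
  (U : CMat d) * (U : CMat d)ᵀ

/-- The entrywise complex conjugate of `U Uᵀ`. -/
def symUnitaryConj (U : unitaryGroup (Fin d) ℂ) : CMat d :=
  (symUnitary U).map (starRingEnd ℂ)

@[fun_prop]
theorem continuous_symUnitary : Continuous (symUnitary (d := d)) := by
  have h : Continuous fun U : unitaryGroup (Fin d) ℂ => (U : CMat d) := continuous_subtype_val
  exact h.matrix_mul h.matrix_transpose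

@[fun_prop]
theorem continuous_symUnitaryConj : Continuous (symUnitaryConj (d := d)) :=
  continuous_symUnitary.matrix_map Complex.continuous_conj

theorem transpose_symUnitary (U : unitaryGroup (Fin d) ℂ) : (symUnitary U)ᵀ = symUnitary U := by
  rw [symUnitary, transpose_mul, transpose_transpose]

theorem transpose_symUnitaryConj (U : unitaryGroup (Fin d) ℂ) :
    (symUnitaryConj U)ᵀ = symUnitaryConj U := by
  rw [symUnitaryConj, ← transpose_map, transpose_symUnitary]

theorem transpose_mul_map_conj (U : unitaryGroup (Fin d) ℂ) :
    (U : CMat d)ᵀ * (U : CMat d).map (starRingEnd ℂ) = 1 := by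
  have h : (U : CMat d)ᴴ * (U : CMat d) = 1 := mem_unitaryGroup_iff'.1 U.2
  have h2 := congrArg Matrix.transpose h
  rw [transpose_mul, transpose_one] at h2
  exact h2

theorem conjTranspose_mul_self (U : unitaryGroup (Fin d) ℂ) :
    (U : CMat d)ᴴ * (U : CMat d) = 1 := mem_unitaryGroup_iff'.1 U.2

theorem mul_conjTranspose_self (U : unitaryGroup (Fin d) ℂ) :
    (U : CMat d) * (U : CMat d)ᴴ = 1 := mem_unitaryGroup_iff.1 U.2

/-- This cancellation lowers the degree of every contraction of `W` with its conjugate, which is why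
the moment relations close. -/
theorem symUnitary_mul_symUnitaryConj (U : unitaryGroup (Fin d) ℂ) :
    symUnitary U * symUnitaryConj U = 1 := by
  have e : symUnitaryConj U = (U : CMat d).map (starRingEnd ℂ) * (U : CMat d)ᴴ := by
    rw [symUnitaryConj, symUnitary, Matrix.map_mul]; rfl
  rw [e, symUnitary, Matrix.mul_assoc, ← Matrix.mul_assoc _ _ (U : CMat d)ᴴ,
    transpose_mul_map_conj, Matrix.one_mul, mul_conjTranspose_self]

theorem hasEntryDerivAt_symUnitary (A : CMat d) (hA : Aᴴ = -A) (U : unitaryGroup (Fin d) ℂ) :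
    HasEntryDerivAt (fun t => symUnitary (oneParam A hA t * U))
      (A * symUnitary U + symUnitary U * Aᵀ) := by
  have h := hasEntryDerivAt_oneParam A hA U
  have h2 := h.mul h.transpose
  simp only [oneParam_zero, one_mul, transpose_mul] at h2
  rw [symUnitary, ← Matrix.mul_assoc, Matrix.mul_assoc (U : CMat d)]
  exact h2

/-- For skew-Hermitian `A` the conjugate of `A` is `-Aᵀ`. Written this way, the derivative is
complex linear in `A` rather than conjugate linear, as complexification requires. -/
theorem hasEntryDerivAt_symUnitaryConj (A : CMat d) (hA : Aᴴ = -A) (U : unitaryGroup (Fin d) ℂ) :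
    HasEntryDerivAt (fun t => symUnitaryConj (oneParam A hA t * U))
      (-(Aᵀ * symUnitaryConj U + symUnitaryConj U * A)) := by
  have h := (hasEntryDerivAt_symUnitary A hA U).conj
  have e1 : A.map (starRingEnd ℂ) = -Aᵀ := by
    have := congrArg Matrix.transpose hA
    rw [transpose_neg] at this
    exact this
  have e2 : Aᵀ.map (starRingEnd ℂ) = -A := hA
  rw [Matrix.map_add _ (map_add _), Matrix.map_mul, Matrix.map_mul, e1, e2] at h
  rw [neg_add, ← Matrix.neg_mul, ← Matrix.mul_neg]
  exact h

/-- Every matrix is `S₁ + i S₂` with `S₁`, `S₂` skew-Hermitian, so linearity carries the vanishing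
from the Lie algebra to all matrices, in particular to the elementary matrices, which are not
skew-Hermitian in general. -/
theorem integral_eq_zero_of_isLinearMap {f : unitaryGroup (Fin d) ℂ → ℂ}
    {g : CMat d → unitaryGroup (Fin d) ℂ → ℂ} (hf : Continuous f) (hg : ∀ A, Continuous (g A))
    (hlin : ∀ U, IsLinearMap ℂ fun A => g A U)
    (h : ∀ A (hA : Aᴴ = -A) U, HasDerivAt (fun t => f (oneParam A hA t * U)) (g A U) 0)
    (A : CMat d) : ∫ U, g A U ∂haar d ℂ = 0 := by
  set S₁ : CMat d := (1 / 2 : ℂ) • (A - Aᴴ)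
  set S₂ : CMat d := (-Complex.I / 2) • (A + Aᴴ)
  have hA : A = S₁ + Complex.I • S₂ := by
    simp only [S₁, S₂, smul_smul]
    have : Complex.I * (-Complex.I / 2) = 1 / 2 := by
      linear_combination (-1 / 2 : ℂ) * Complex.I_mul_I
    rw [this, ← smul_add, sub_add_add_cancel, ← two_smul ℂ A, smul_smul]
    norm_num
  have h₁ : S₁ᴴ = -S₁ := by
    simp only [S₁, conjTranspose_smul, conjTranspose_sub, conjTranspose_conjTranspose]
    rw [← smul_neg, neg_sub]
    simp
  have h₂ : S₂ᴴ = -S₂ := by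
    simp only [S₂, conjTranspose_smul, conjTranspose_add, conjTranspose_conjTranspose]
    rw [← neg_smul, add_comm]
    congr 1
    simp [neg_div]
  have e : ∀ U, g A U = g S₁ U + Complex.I * g S₂ U := by
    intro U
    have := (hlin U).map_add S₁ (Complex.I • S₂)
    simp only [(hlin U).map_smul, smul_eq_mul, ← hA] at this
    exact this
  simp only [e]
  rw [integral_add (integrable_haar (hg _)) ((integrable_haar (hg _)).const_mul _),
    integral_const_mul, integral_eq_zero_of_hasDerivAt_oneParam h₁ hf (hg S₁) (h S₁ h₁),
    integral_eq_zero_of_hasDerivAt_oneParam h₂ hf (hg S₂) (h S₂ h₂)]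
  simp

/-- Summed integration by parts over the complexified Lie algebra of the unitary group. -/
theorem integral_sum_single_eq_zero {f : Fin d → Fin d → unitaryGroup (Fin d) ℂ → ℂ}
    {g : Fin d → Fin d → CMat d → unitaryGroup (Fin d) ℂ → ℂ} (hf : ∀ a b, Continuous (f a b))
    (hg : ∀ a b A, Continuous (g a b A)) (hlin : ∀ a b U, IsLinearMap ℂ fun A => g a b A U)
    (h : ∀ a b A (hA : Aᴴ = -A) U,
      HasDerivAt (fun t => f a b (oneParam A hA t * U)) (g a b A U) 0) :
    ∫ U, ∑ a, ∑ b, g a b (single a b 1) U ∂haar d ℂ = 0 := by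
  rw [integral_finsetSum _ fun a _ => integrable_finsetSum _ fun b _ =>
    integrable_haar (hg a b _)]
  refine Finset.sum_eq_zero fun a _ => ?_
  rw [integral_finsetSum _ fun b _ => integrable_haar (hg a b _)]
  exact Finset.sum_eq_zero fun b _ =>
    integral_eq_zero_of_isLinearMap (hf a b) (hg a b) (hlin a b) (h a b) _

theorem sum_single_mul_apply (Q : CMat d) :
    ∑ a, ∑ b, (single a b 1 * Q : CMat d) a b = d * Q.trace := by
  simpa using sum_mul_single_mul_apply 1 Q

theorem sum_mul_single_swap_apply (P : CMat d) :
    ∑ a, ∑ b, (P * single b a 1 : CMat d) a b = P.trace := by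
  simpa using sum_mul_single_swap_mul_apply P 1

theorem sum_mul_trace_single_mul (Q K : CMat d) :
    ∑ a, ∑ b, Q a b * (single a b 1 * K : CMat d).trace = (Q * K).trace := by
  simp only [Matrix.trace_single_mul]
  simp [Matrix.trace, Matrix.mul_apply]

theorem sum_mul_trace_mul_single_swap (Q K : CMat d) :
    ∑ a, ∑ b, Q a b * (K * single b a 1 : CMat d).trace = (Q * Kᵀ).trace := by
  simp only [Matrix.trace_mul_single]
  simp [Matrix.trace, Matrix.mul_apply]

/-- The two terms of the derivative contract equally because `W` is symmetric, hence the factor 2;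
for the conjugate the sign is reversed. -/
theorem sum_mul_trace_symUnitary_deriv (Q : CMat d) (U : unitaryGroup (Fin d) ℂ) :
    ∑ a, ∑ b, Q a b
      * (single a b 1 * symUnitary U + symUnitary U * (single a b 1)ᵀ : CMat d).trace
      = 2 * (Q * symUnitary U).trace := by
  simp only [transpose_single, Matrix.trace_add, mul_add, Finset.sum_add_distrib,
    sum_mul_trace_single_mul, sum_mul_trace_mul_single_swap, transpose_symUnitary]
  ring

theorem sum_mul_trace_symUnitaryConj_deriv (Q : CMat d) (U : unitaryGroup (Fin d) ℂ) :
    ∑ a, ∑ b, Q a b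
      * (-((single a b 1)ᵀ * symUnitaryConj U + symUnitaryConj U * single a b 1) : CMat d).trace
      = -2 * (Q * symUnitaryConj U).trace := by
  have : ∀ a b : Fin d,
      (-((single a b 1)ᵀ * symUnitaryConj U + symUnitaryConj U * single a b 1) : CMat d).trace
      = -((symUnitaryConj U * single b a 1 : CMat d).trace
        + (single a b 1 * symUnitaryConj U : CMat d).trace) := by
    intro a b
    rw [trace_neg, trace_add, transpose_single, trace_mul_comm, trace_mul_comm (single a b 1)]
  simp only [this, mul_neg, mul_add, Finset.sum_add_distrib, Finset.sum_neg_distrib,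
    sum_mul_trace_single_mul, sum_mul_trace_mul_single_swap, transpose_symUnitaryConj]
  ring

theorem sum_symUnitary_deriv (U : unitaryGroup (Fin d) ℂ) :
    ∑ a, ∑ b, (single a b 1 * symUnitary U + symUnitary U * (single a b 1)ᵀ : CMat d) a b
      = (d + 1) * (symUnitary U).trace := by
  simp only [transpose_single, Matrix.add_apply, Finset.sum_add_distrib, sum_single_mul_apply,
    sum_mul_single_swap_apply]
  ring

/-- The second moment of `tr (U Uᵀ)`. -/
theorem integral_trace_mul_trace :
    ((d : ℂ) + 1) * ∫ U, (symUnitary U).trace * (symUnitaryConj U).trace ∂haar d ℂ = 2 * d := by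
  have h := integral_sum_single_eq_zero (d := d)
    (f := fun a b U => symUnitary U a b * (symUnitaryConj U).trace)
    (g := fun a b A U => (A * symUnitary U + symUnitary U * Aᵀ : CMat d) a b
        * (symUnitaryConj U).trace
      + symUnitary U a b * (-(Aᵀ * symUnitaryConj U + symUnitaryConj U * A) : CMat d).trace)
    (fun a b => by fun_prop) (fun a b A => by fun_prop)
    (fun a b U => by
      constructor <;> intros <;>
        simp only [Matrix.add_mul, Matrix.mul_add, Matrix.add_apply, trace_add, trace_neg,
          transpose_add, transpose_smul, Matrix.smul_mul, Matrix.mul_smul, Matrix.smul_apply,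
          trace_smul, smul_eq_mul] <;> ring)
    (fun a b A hA U => by
      have := (hasEntryDerivAt_symUnitary A hA U a b).fun_mul
        (hasEntryDerivAt_symUnitaryConj A hA U).trace
      simpa only [oneParam_zero, one_mul] using this)
  have key : ∫ U, (((d : ℂ) + 1)
      * ((symUnitary U).trace * (symUnitaryConj U).trace) - 2 * d) ∂haar d ℂ = 0 := by
    rw [← h]
    refine integral_congr_ae (.of_forall fun U => Eq.symm ?_)
    beta_reduce
    have e1 := sum_symUnitary_deriv U
    have e2 := sum_mul_trace_symUnitaryConj_deriv (symUnitary U) U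
    rw [symUnitary_mul_symUnitaryConj, trace_one, Fintype.card_fin] at e2
    rw [show ((d : ℂ) + 1) * ((symUnitary U).trace * (symUnitaryConj U).trace) - 2 * d
      = (d + 1) * (symUnitary U).trace * (symUnitaryConj U).trace + -2 * d by ring,
      ← e1, ← e2]
    simp only [Finset.sum_mul, ← Finset.sum_add_distrib]
  rw [integral_sub (integrable_haar (by fun_prop)) (integrable_const _), integral_const_mul] at key
  simpa [sub_eq_zero] using key

/-- A linear relation between fourth moments of `U Uᵀ`, from integration by parts of the entries
of `W` times `tr W (tr W̄)²`, for `W = U Uᵀ`. -/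
theorem integral_trace_sq_relation :
    ((d : ℂ) + 1) * ∫ U, (symUnitary U).trace ^ 2 * (symUnitaryConj U).trace ^ 2 ∂haar d ℂ
      + 2 * ∫ U, (symUnitary U * symUnitary U).trace * (symUnitaryConj U).trace ^ 2 ∂haar d ℂ
      = 4 * d * ∫ U, (symUnitary U).trace * (symUnitaryConj U).trace ∂haar d ℂ := by
  have h := integral_sum_single_eq_zero (d := d)
    (f := fun a b U => symUnitary U a b
      * ((symUnitary U).trace * ((symUnitaryConj U).trace * (symUnitaryConj U).trace)))
    (g := fun a b A U => (A * symUnitary U + symUnitary U * Aᵀ : CMat d) a b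
        * ((symUnitary U).trace * ((symUnitaryConj U).trace * (symUnitaryConj U).trace))
      + symUnitary U a b * ((A * symUnitary U + symUnitary U * Aᵀ : CMat d).trace
          * ((symUnitaryConj U).trace * (symUnitaryConj U).trace)
        + (symUnitary U).trace
          * ((-(Aᵀ * symUnitaryConj U + symUnitaryConj U * A) : CMat d).trace
            * (symUnitaryConj U).trace
          + (symUnitaryConj U).trace
            * (-(Aᵀ * symUnitaryConj U + symUnitaryConj U * A) : CMat d).trace)))
    (fun a b => by fun_prop) (fun a b A => by fun_prop)
    (fun a b U => by
      constructor <;> intros <;>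
        simp only [Matrix.add_mul, Matrix.mul_add, Matrix.add_apply, trace_add, trace_neg,
          transpose_add, transpose_smul, Matrix.smul_mul, Matrix.mul_smul, Matrix.smul_apply,
          trace_smul, smul_eq_mul] <;> ring)
    (fun a b A hA U => by
      have hW := hasEntryDerivAt_symUnitary A hA U
      have hV := (hasEntryDerivAt_symUnitaryConj A hA U).trace
      have := (hW a b).fun_mul (hW.trace.fun_mul (hV.fun_mul hV))
      simpa only [oneParam_zero, one_mul] using this)
  have key : ∫ U, (((d : ℂ) + 1)
      * ((symUnitary U).trace ^ 2 * (symUnitaryConj U).trace ^ 2)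
      + 2 * ((symUnitary U * symUnitary U).trace * (symUnitaryConj U).trace ^ 2)
      - 4 * d * ((symUnitary U).trace * (symUnitaryConj U).trace)) ∂haar d ℂ = 0 := by
    rw [← h]
    refine integral_congr_ae (.of_forall fun U => Eq.symm ?_)
    beta_reduce
    have e1 := sum_symUnitary_deriv U
    have e2 := sum_mul_trace_symUnitaryConj_deriv (symUnitary U) U
    have e3 := sum_mul_trace_symUnitary_deriv (symUnitary U) U
    rw [symUnitary_mul_symUnitaryConj, trace_one, Fintype.card_fin] at e2
    trans ((d : ℂ) + 1) * (symUnitary U).trace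
        * ((symUnitary U).trace * ((symUnitaryConj U).trace * (symUnitaryConj U).trace))
      + (2 * (symUnitary U * symUnitary U).trace)
        * ((symUnitaryConj U).trace * (symUnitaryConj U).trace)
      + (-2 * d) * (2 * (symUnitary U).trace * (symUnitaryConj U).trace)
    · rw [← e1, ← e2, ← e3]
      simp only [Finset.sum_mul, ← Finset.sum_add_distrib]
      refine Finset.sum_congr rfl fun a _ => Finset.sum_congr rfl fun b _ => ?_
      ring
    · ring
  rw [integral_sub (integrable_haar (by fun_prop)) (integrable_haar (by fun_prop)),
    integral_add (integrable_haar (by fun_prop)) (integrable_haar (by fun_prop))] at key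
  simp only [integral_const_mul] at key
  exact sub_eq_zero.1 key

/-- A linear relation between fourth moments of `U Uᵀ`, from integration by parts of the entries
of `W²` times `(tr W̄)²`, for `W = U Uᵀ`. -/
theorem integral_trace_mul_self_relation :
    ((d : ℂ) + 2)
        * ∫ U, (symUnitary U * symUnitary U).trace * (symUnitaryConj U).trace ^ 2 ∂haar d ℂ
      + ∫ U, (symUnitary U).trace ^ 2 * (symUnitaryConj U).trace ^ 2 ∂haar d ℂ
      = 4 * ∫ U, (symUnitary U).trace * (symUnitaryConj U).trace ∂haar d ℂ := by
  have h := integral_sum_single_eq_zero (d := d)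
    (f := fun a b U => (symUnitary U * symUnitary U : CMat d) a b
      * ((symUnitaryConj U).trace * (symUnitaryConj U).trace))
    (g := fun a b A U => ((A * symUnitary U + symUnitary U * Aᵀ) * symUnitary U
        + symUnitary U * (A * symUnitary U + symUnitary U * Aᵀ) : CMat d) a b
        * ((symUnitaryConj U).trace * (symUnitaryConj U).trace)
      + (symUnitary U * symUnitary U : CMat d) a b
        * ((-(Aᵀ * symUnitaryConj U + symUnitaryConj U * A) : CMat d).trace
            * (symUnitaryConj U).trace
          + (symUnitaryConj U).trace
            * (-(Aᵀ * symUnitaryConj U + symUnitaryConj U * A) : CMat d).trace))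
    (fun a b => by fun_prop) (fun a b A => by fun_prop)
    (fun a b U => by
      constructor <;> intros <;>
        simp only [Matrix.add_mul, Matrix.mul_add, Matrix.add_apply, trace_add, trace_neg,
          transpose_add, transpose_smul, Matrix.smul_mul, Matrix.mul_smul, Matrix.smul_apply,
          trace_smul, smul_eq_mul] <;> ring)
    (fun a b A hA U => by
      have hW := hasEntryDerivAt_symUnitary A hA U
      have hV := (hasEntryDerivAt_symUnitaryConj A hA U).trace
      have := (hW.mul hW a b).fun_mul (hV.fun_mul hV)
      simpa only [oneParam_zero, one_mul] using this)
  have key : ∫ U, (((d : ℂ) + 2)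
      * ((symUnitary U * symUnitary U).trace * (symUnitaryConj U).trace ^ 2)
      + (symUnitary U).trace ^ 2 * (symUnitaryConj U).trace ^ 2
      - 4 * ((symUnitary U).trace * (symUnitaryConj U).trace)) ∂haar d ℂ = 0 := by
    rw [← h]
    refine integral_congr_ae (.of_forall fun U => Eq.symm ?_)
    beta_reduce
    -- Of the four terms, `W E_ab W` gives `(tr W)²`; the others give `d`, 1 and 1 times `tr W²`.
    have e1 : ∑ a, ∑ b, ((single a b 1 * symUnitary U + symUnitary U * (single a b 1)ᵀ)
        * symUnitary U + symUnitary U * (single a b 1 * symUnitary U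
        + symUnitary U * (single a b 1)ᵀ) : CMat d) a b
        = (d + 2) * (symUnitary U * symUnitary U).trace + (symUnitary U).trace ^ 2 := by
      simp only [transpose_single, Matrix.add_mul, Matrix.mul_add, ← Matrix.mul_assoc,
        Matrix.add_apply, Finset.sum_add_distrib, sum_mul_single_mul_apply,
        sum_mul_single_swap_mul_apply, sum_mul_single_swap_apply, transpose_symUnitary]
      simp only [Matrix.mul_assoc, sum_single_mul_apply]
      ring
    have e2 := sum_mul_trace_symUnitaryConj_deriv (symUnitary U * symUnitary U) U
    rw [Matrix.mul_assoc, symUnitary_mul_symUnitaryConj, Matrix.mul_one] at e2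
    trans (((d : ℂ) + 2) * (symUnitary U * symUnitary U).trace + (symUnitary U).trace ^ 2)
        * ((symUnitaryConj U).trace * (symUnitaryConj U).trace)
      + (-2 * (symUnitary U).trace) * (2 * (symUnitaryConj U).trace)
    · rw [← e1, ← e2]
      simp only [Finset.sum_mul, ← Finset.sum_add_distrib]
      refine Finset.sum_congr rfl fun a _ => Finset.sum_congr rfl fun b _ => ?_
      ring
    · ring
  rw [integral_sub (integrable_haar (by fun_prop)) (integrable_haar (by fun_prop)),
    integral_add (integrable_haar (by fun_prop)) (integrable_haar (by fun_prop))] at key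
  simp only [integral_const_mul] at key
  exact sub_eq_zero.1 key

/-- The fourth moment of `tr (U Uᵀ)`. -/
theorem integral_trace_sq_mul_trace_sq (hd : d ≠ 0) :
    ((d : ℂ) + 1) * (d + 3)
        * ∫ U, (symUnitary U).trace ^ 2 * (symUnitaryConj U).trace ^ 2 ∂haar d ℂ
      = 8 * (d ^ 2 + 2 * d - 2) := by
  have r1 := integral_trace_sq_relation (d := d)
  have r2 := integral_trace_mul_self_relation (d := d)
  have r0 := integral_trace_mul_trace (d := d)
  have d0 : (d : ℂ) ≠ 0 := by exact_mod_cast hd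
  set x := ∫ U, (symUnitary U).trace ^ 2 * (symUnitaryConj U).trace ^ 2 ∂haar d ℂ
  set y := ∫ U, (symUnitary U * symUnitary U).trace * (symUnitaryConj U).trace ^ 2 ∂haar d ℂ
  set z := ∫ U, (symUnitary U).trace * (symUnitaryConj U).trace ∂haar d ℂ
  -- Eliminating `y` leaves `x` with coefficient `(d+1)(d+2) - 2 = d(d+3)`, whose factor `d` has to
  -- be cancelled.
  refine mul_left_cancel₀ d0 ?_
  linear_combination ((d : ℂ) + 1) * (d + 2) * r1 - 2 * ((d : ℂ) + 1) * r2
    + (4 * d * (d + 2) - 8) * r0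

end UnitaryMoments

/-! ### The generating power as a function of the trace of `U Uᵀ`, and its variance. -/

section GeneratingPower

variable {d : ℕ}

open scoped ComplexOrder in
theorem hsNorm_sq (A : CMat d) : hsNorm A ^ 2 = (Aᴴ * A).trace.re := by
  rw [hsNorm, Real.sq_sqrt]
  have h : (0 : ℂ) ≤ (Aᴴ * A).trace := (posSemidef_conjTranspose_mul_self A).trace_nonneg
  exact (Complex.le_def.1 h).1

theorem trace_map_conj (A : CMat d) :
    (A.map (starRingEnd ℂ)).trace = starRingEnd ℂ A.trace := by
  simp [Matrix.trace]

theorem imaginarity_of_isHermitian {ρ : CMat d} (h : ρᴴ = ρ) :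
    imaginarity ρ = ((ρ * ρ).trace.re - (ρ * ρ.map (starRingEnd ℂ)).trace.re) / 2 := by
  have hc : (ρ.map (starRingEnd ℂ))ᴴ = ρ.map (starRingEnd ℂ) := by
    have := congrArg (fun M : CMat d => M.map (starRingEnd ℂ)) h
    exact this
  have h2 : (ρ.map (starRingEnd ℂ) * ρ.map (starRingEnd ℂ)).trace
      = starRingEnd ℂ (ρ * ρ).trace := by
    rw [← Matrix.map_mul, trace_map_conj]
  rw [imaginarity, hsNorm_sq, conjTranspose_smul, conjTranspose_sub, h, hc, Matrix.smul_mul,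
    Matrix.mul_smul, smul_smul, trace_smul, Matrix.sub_mul, Matrix.mul_sub, Matrix.mul_sub,
    trace_sub, trace_sub, trace_sub, h2, trace_mul_comm (ρ.map (starRingEnd ℂ)) ρ]
  have : star (1 / 2 : ℂ) * (1 / 2) = ((1 / 4 : ℝ) : ℂ) := by
    apply Complex.ext <;> norm_num
  rw [this, smul_eq_mul, Complex.re_ofReal_mul]
  simp only [Complex.sub_re, Complex.conj_re]
  ring

theorem map_conj_realState (O : orthogonalGroup (Fin d) ℝ) (l : Fin d → ℝ) :
    (realState O l).map (starRingEnd ℂ) = realState O l := by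
  ext i j
  exact Complex.conj_ofReal _

theorem conjTranspose_realState (O : orthogonalGroup (Fin d) ℝ) (l : Fin d → ℝ) :
    (realState O l)ᴴ = realState O l := by
  have h := transpose_realState O l
  rw [← map_conj_realState, ← transpose_map] at h
  rw [map_conj_realState] at h
  exact h

/-- The imaginarity of `U X U†` for a real state `X`. -/
theorem imaginarity_conj_realState (U : unitaryGroup (Fin d) ℂ) (O : orthogonalGroup (Fin d) ℝ)
    {l : Fin d → ℝ} {P : ℝ} (h2 : ∑ i, l i ^ 2 = P) :
    imaginarity ((U : CMat d) * realState O l * (U : CMat d)ᴴ)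
      = (P - (realState O l * ((U : CMat d)ᴴ * (U : CMat d).map (starRingEnd ℂ))
          * realState O l * ((U : CMat d)ᵀ * (U : CMat d))).trace.re) / 2 := by
  have hX := conjTranspose_realState O l
  have hXc := map_conj_realState O l
  have hXX := realState_mul_self O l
  have ht := trace_realState O fun i => l i ^ 2
  rw [h2] at ht
  set X := realState O l
  have hmap : ((U : CMat d)ᴴ).map (starRingEnd ℂ) = (U : CMat d)ᵀ := by
    ext i j; simp
  rw [imaginarity_of_isHermitian (by
    simp only [conjTranspose_mul, conjTranspose_conjTranspose, hX, Matrix.mul_assoc])]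
  have e1 : ((U : CMat d) * X * (U : CMat d)ᴴ * ((U : CMat d) * X * (U : CMat d)ᴴ)).trace
      = P := by
    rw [← ht, ← hXX]
    calc _ = (X * ((U : CMat d)ᴴ * (U : CMat d)) * X * ((U : CMat d)ᴴ * (U : CMat d))).trace := by
          rw [Matrix.mul_assoc, Matrix.mul_assoc, trace_mul_comm]; simp only [Matrix.mul_assoc]
      _ = _ := by rw [conjTranspose_mul_self, Matrix.mul_one, Matrix.mul_one]
  -- As `X` is real, conjugation acts only on the unitary factors; cyclicity then groups them into
  -- the two symmetric matrices on either side of `X`.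
  have e2 : ((U : CMat d) * X * (U : CMat d)ᴴ
      * ((U : CMat d) * X * (U : CMat d)ᴴ).map (starRingEnd ℂ)).trace
      = (X * ((U : CMat d)ᴴ * (U : CMat d).map (starRingEnd ℂ)) * X
        * ((U : CMat d)ᵀ * (U : CMat d))).trace := by
    rw [Matrix.map_mul, Matrix.map_mul, hXc, hmap, Matrix.mul_assoc, Matrix.mul_assoc,
      trace_mul_comm]
    simp only [Matrix.mul_assoc]
  rw [e1, e2, Complex.ofReal_re]

theorem trace_symUnitaryConj (U : unitaryGroup (Fin d) ℂ) :
    (symUnitaryConj U).trace = starRingEnd ℂ (symUnitary U).trace := trace_map_conj _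

/-- The Haar average over real states of a given spectrum of the imaginarity of `U X U†`. -/
theorem integral_imaginarity (hd : 2 ≤ d) (U : unitaryGroup (Fin d) ℂ) {l : Fin d → ℝ} {P : ℝ}
    (hl : l ∈ spectra d P) :
    ∫ O, imaginarity ((U : CMat d) * realState O l * (U : CMat d)ᴴ) ∂haar d ℝ
      = (P - 1 / d) / (2 * ((d - 1) * (d + 2)))
        * (d ^ 2 - Complex.normSq (symUnitary U).trace) := by
  obtain ⟨-, h1, h2⟩ := hl
  simp only [imaginarity_conj_realState U _ h2]
  set B : CMat d := (U : CMat d)ᵀ * (U : CMat d)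
  set C : CMat d := (U : CMat d)ᴴ * (U : CMat d).map (starRingEnd ℂ)
  have hB : Bᵀ = B := by simp only [B, transpose_mul, transpose_transpose]
  have hBC' : C = B.map (starRingEnd ℂ) := by
    simp only [B, C, Matrix.map_mul]; rfl
  have hC : Cᵀ = C := by rw [hBC', ← transpose_map, hB]
  have hBC : B * C = 1 := by
    simp only [B, C]
    rw [Matrix.mul_assoc, ← Matrix.mul_assoc (U : CMat d), mul_conjTranspose_self, Matrix.one_mul,
      transpose_mul_map_conj]
  have hBt : B.trace = (symUnitary U).trace := trace_mul_comm _ _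
  have hCt : C.trace = starRingEnd ℂ (symUnitary U).trace := by
    rw [hBC', trace_map_conj, hBt]
  have hint := integral_trace_mul_mul_mul hd h1 h2 hB hC hBC
  have hX := continuous_realState l
  have hI : Integrable (fun O => (realState O l * C * realState O l * B).trace) (haar d ℝ) :=
    integrable_haar (by fun_prop)
  have hR : Integrable (fun O => (realState O l * C * realState O l * B).trace.re) (haar d ℝ) :=
    hI.re
  rw [integral_div, integral_sub (integrable_const _) hR]
  have hre : ∫ O, (realState O l * C * realState O l * B).trace.re ∂haar d ℝ
      = (∫ O, (realState O l * C * realState O l * B).trace ∂haar d ℝ).re := integral_re hI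
  rw [hre, hint, hBt, hCt, Complex.mul_conj]
  have : (P : ℂ) - (P - 1 / d) / ((d - 1) * (d + 2))
      * (d ^ 2 - (Complex.normSq (symUnitary U).trace : ℂ))
      = ((P - (P - 1 / d) / ((d - 1) * (d + 2))
        * (d ^ 2 - Complex.normSq (symUnitary U).trace) : ℝ) : ℂ) := by push_cast; ring
  rw [this, Complex.ofReal_re, integral_const, probReal_univ, one_smul]
  generalize ((d : ℝ) - 1) * (d + 2) = D
  ring

/-- The inner average takes the same value at every spectrum of purity `P`, so integrating over the
probability measure `ν` changes nothing. -/
theorem igp_eq (hd : 2 ≤ d) {P : ℝ} {ν : Measure (Fin d → ℝ)} (hν : IsSpectralDistribution P ν)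
    (U : unitaryGroup (Fin d) ℂ) :
    igp ν U = (P - 1 / d) / (2 * ((d - 1) * (d + 2)))
      * (d ^ 2 - Complex.normSq (symUnitary U).trace) := by
  have := hν.isProbabilityMeasure
  rw [igp, integral_congr_ae (hν.ae_mem_spectra.mono fun l hl => integral_imaginarity hd U hl)]
  simp

/-- There is a unitary matrix `U` with `tr (U Uᵀ) = 0`. -/
theorem exists_trace_symUnitary_eq_zero (hd : 2 ≤ d) :
    ∃ U : unitaryGroup (Fin d) ℂ, (symUnitary U).trace = 0 := by
  have d0 : (d : ℂ) ≠ 0 := by exact_mod_cast (by omega : d ≠ 0)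
  -- The angles are halved so that the squares `u k ^ 2` run through the `d`-th roots of unity,
  -- whose sum is 0 because `d ≥ 2`.
  let u : Fin d → ℂ := fun k => Complex.exp ((Real.pi * k / d : ℝ) * Complex.I)
  have hu : ∀ k, u k * starRingEnd ℂ (u k) = 1 := by
    intro k
    rw [Complex.mul_conj, Complex.normSq_eq_norm_sq, Complex.norm_exp_ofReal_mul_I]
    norm_num
  refine ⟨⟨diagonal u, ?_⟩, ?_⟩
  · rw [mem_unitaryGroup_iff, star_eq_conjTranspose, diagonal_conjTranspose,
      diagonal_mul_diagonal, ← diagonal_one]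
    congr 1
    ext k
    exact hu k
  · have h := (Complex.isPrimitiveRoot_exp d (by omega)).geom_sum_eq_zero (by omega)
    rw [symUnitary, diagonal_transpose, diagonal_mul_diagonal, trace_diagonal, ← h,
      ← Fin.sum_univ_eq_sum_range]
    refine Finset.sum_congr rfl fun k _ => ?_
    rw [← Complex.exp_nat_mul, ← Complex.exp_add]
    congr 1
    push_cast
    field_simp
    ring

theorem coefficient_pos (hd : 2 ≤ d) {P : ℝ} (hP : 1 / (d : ℝ) < P) :
    0 < (P - 1 / d) / (2 * (((d : ℝ) - 1) * (d + 2))) := by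
  have : (2 : ℝ) ≤ d := by exact_mod_cast hd
  have h1 : (0 : ℝ) < d - 1 := by linarith
  have h2 : 0 < P - 1 / d := sub_pos.2 hP
  positivity

theorem igpMax_eq (hd : 2 ≤ d) {P : ℝ} (hP : 1 / (d : ℝ) < P) {ν : Measure (Fin d → ℝ)}
    (hν : IsSpectralDistribution P ν) :
    igpMax ν = (P - 1 / d) / (2 * ((d - 1) * (d + 2))) * d ^ 2 := by
  obtain ⟨U₀, h₀⟩ := exists_trace_symUnitary_eq_zero hd
  have hle : ∀ U : unitaryGroup (Fin d) ℂ,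
      igp ν U ≤ (P - 1 / d) / (2 * ((d - 1) * (d + 2))) * d ^ 2 := by
    intro U
    rw [igp_eq hd hν]
    exact mul_le_mul_of_nonneg_left (sub_le_self _ (Complex.normSq_nonneg _))
      (coefficient_pos hd hP).le
  refine le_antisymm (ciSup_le hle) ?_
  refine le_ciSup_of_le ⟨_, Set.forall_mem_range.2 hle⟩ U₀ ?_
  rw [igp_eq hd hν, h₀]
  simp

/-- The positive prefactor containing `P` cancels in the quotient, which makes all later bounds
uniform in `P` and `ν`. -/
theorem normalizedIGP_eq (hd : 2 ≤ d) {P : ℝ} (hP : 1 / (d : ℝ) < P) {ν : Measure (Fin d → ℝ)}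
    (hν : IsSpectralDistribution P ν) (U : unitaryGroup (Fin d) ℂ) :
    normalizedIGP ν U = 1 - Complex.normSq (symUnitary U).trace / d ^ 2 := by
  have d0 : (d : ℝ) ≠ 0 := by exact_mod_cast (by omega : d ≠ 0)
  rw [normalizedIGP, igp_eq hd hν, igpMax_eq hd hP hν,
    mul_div_mul_left _ _ (coefficient_pos hd hP).ne']
  field_simp

theorem integral_normSq :
    ∫ U, Complex.normSq (symUnitary U).trace ∂haar d ℂ = 2 * d / (d + 1) := by
  have h := integral_trace_mul_trace (d := d)
  simp only [trace_symUnitaryConj, Complex.mul_conj] at h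
  rw [integral_complex_ofReal] at h
  rw [eq_div_iff (by positivity), mul_comm]
  exact_mod_cast h

theorem integral_normSq_sq (hd : d ≠ 0) :
    ∫ U, Complex.normSq (symUnitary U).trace ^ 2 ∂haar d ℂ
      = 8 * (d ^ 2 + 2 * d - 2) / ((d + 1) * (d + 3)) := by
  have h := integral_trace_sq_mul_trace_sq hd
  simp only [trace_symUnitaryConj, ← mul_pow, Complex.mul_conj, ← Complex.ofReal_pow] at h
  rw [integral_complex_ofReal] at h
  rw [eq_div_iff (by positivity), mul_comm]
  exact_mod_cast h

theorem continuous_normSq_trace :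
    Continuous fun U : unitaryGroup (Fin d) ℂ => Complex.normSq (symUnitary U).trace :=
  Complex.continuous_normSq.comp (by fun_prop)

theorem memLp_haar {f : unitaryGroup (Fin d) ℂ → ℝ} (hf : Continuous f) (p : ENNReal) :
    MemLp f p (haar d ℂ) := by
  obtain ⟨C, hC⟩ := isCompact_univ.exists_bound_of_continuousOn hf.continuousOn
  exact MemLp.of_bound hf.aestronglyMeasurable C (.of_forall fun U => hC U trivial)

/-- The variance of `|tr (U Uᵀ)|²`. -/
theorem variance_normSq (hd : d ≠ 0) :
    variance (fun U => Complex.normSq (symUnitary U).trace) (haar d ℂ)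
      = 8 * (d ^ 2 + 2 * d - 2) / ((d + 1) * (d + 3)) - (2 * d / (d + 1)) ^ 2 := by
  rw [variance_eq_sub (memLp_haar continuous_normSq_trace 2), integral_normSq,
    ← integral_normSq_sq hd]
  rfl

theorem abs_variance_normSq_sub_le (hd : 0 < d) :
    |variance (fun U => Complex.normSq (symUnitary U).trace) (haar d ℂ) - 4| ≤ 48 / d := by
  rw [variance_normSq hd.ne']
  have d0 : (1 : ℝ) ≤ d := by exact_mod_cast hd
  generalize (d : ℝ) = x at d0
  have hx : 0 < x := by linarith
  -- The exact deviation from 4 is of order `1/x`; the constant 48 is generous, as 8 would already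
  -- suffice.
  have e : 8 * (x ^ 2 + 2 * x - 2) / ((x + 1) * (x + 3)) - (2 * x / (x + 1)) ^ 2 - 4
      = -(8 * x ^ 2 + 28 * x + 28) / ((x + 1) ^ 2 * (x + 3)) := by
    field_simp
    ring
  rw [e, neg_div, abs_neg, abs_of_nonneg (by positivity), div_le_div_iff₀ (by positivity) hx]
  nlinarith [mul_nonneg hx.le hx.le, mul_nonneg (mul_nonneg hx.le hx.le) hx.le]

theorem variance_normalizedIGP (hd : 2 ≤ d) {P : ℝ} (hP : 1 / (d : ℝ) < P)
    {ν : Measure (Fin d → ℝ)} (hν : IsSpectralDistribution P ν) :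
    variance (normalizedIGP ν) (haar d ℂ)
      = variance (fun U => Complex.normSq (symUnitary U).trace) (haar d ℂ) / d ^ 4 := by
  have e : normalizedIGP ν = fun U => 1 - (1 / (d : ℝ) ^ 2) * Complex.normSq (symUnitary U).trace :=
    funext fun U => by rw [normalizedIGP_eq hd hP hν]; ring
  rw [e, variance_const_sub (continuous_normSq_trace.const_mul _).aestronglyMeasurable,
    variance_const_mul]
  ring

end GeneratingPower

end ImaginarityPower

end

/-! ### The variance bounds. -/

theorem proposition3 :
    ∃ C : ℝ, ∀ (d : ℕ), 2 ≤ d → ∀ (P : ℝ), 1 / (d : ℝ) < P →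
      ∀ (ν : Measure (Fin d → ℝ)), ImaginarityPower.IsSpectralDistribution P ν →
        0 < ImaginarityPower.igpMax ν ∧
        MemLp (ImaginarityPower.normalizedIGP ν) 2 (ImaginarityPower.haar d ℂ) ∧
        variance (ImaginarityPower.normalizedIGP ν) (ImaginarityPower.haar d ℂ)
          ≤ C / (d : ℝ) ^ 4 ∧
        |variance (ImaginarityPower.normalizedIGP ν) (ImaginarityPower.haar d ℂ)
          - 4 / (d : ℝ) ^ 4| ≤ C / (d : ℝ) ^ 5 := by
  -- Here `52 = 4 + 48`: the limit 4 plus the error `48 / d ≤ 48` bounds the variance of `|tr W|²`.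
  refine ⟨52, fun d hd P hP ν hν => ?_⟩
  have d0 : (1 : ℝ) ≤ d := by exact_mod_cast (by omega : 1 ≤ d)
  have hpos : (0 : ℝ) < d := by linarith
  have hv := ImaginarityPower.abs_variance_normSq_sub_le (d := d) (by omega)
  rw [ImaginarityPower.variance_normalizedIGP hd hP hν]
  refine ⟨?_, ?_, ?_, ?_⟩
  · rw [ImaginarityPower.igpMax_eq hd hP hν]
    exact mul_pos (ImaginarityPower.coefficient_pos hd hP) (by positivity)
  · refine ImaginarityPower.memLp_haar ?_ 2
    rw [funext (ImaginarityPower.normalizedIGP_eq hd hP hν)]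
    exact continuous_const.sub (ImaginarityPower.continuous_normSq_trace.div_const _)
  · have h48 : 48 / (d : ℝ) ≤ 48 := div_le_self (by norm_num) d0
    have := (abs_le.1 hv).2
    gcongr
    linarith
  · rw [← sub_div, abs_div, abs_of_pos (pow_pos hpos 4), div_le_div_iff₀ (by positivity)
      (by positivity)]
    have h52 : 48 / (d : ℝ) ≤ 52 / d := by gcongr; norm_num
    calc _ ≤ 52 / (d : ℝ) * (d : ℝ) ^ 5 := by gcongr; exact hv.trans h52
      _ = _ := by field_simp
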